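/- **Existence of the quark potential.** Let $m\ge 3$ and $N\ge 1$, and let $B_N=[-N,N]^m\cap\mathbb Z^m$. Let $\Omega^1(B_N,\mathbb Z_2)$ be the set of $\mathbb Z_2$-valued functions $\sigma$ on the oriented nearest-neighbour edges of $B_N$ with $\sigma(-e)=-\sigma(e)$. For $\beta\ge 0$, Ising lattice gauge theory on $B_N$ with free boundary conditions is the probability measure on $\Omega^1(B_N,\mathbb Z_2)$ given by $$\mu_{\beta,N}(\sigma)=Z_{\beta,N}^{-1}\exp\Big(\beta\sum_{p}\rho(d\sigma(p))\Big),$$ where the sum runs over all oriented plaquettes $p$ of $B_N$ (both orientations), $d\sigma(p)=\sum_{e\in\partial p}\sigma(e)$, and $\rho(0)=1$, $\rho(1)=-1$. For a loop $\gamma$ in $B_N$ let $W_\gamma=\prod_{e\in\gamma}\rho(\sigma(e))$, let $\mathbb E_{\beta,N}[W_\gamma]$ be its expectation under $\mu_{\beta,N}$, and let $\langle W_\gamma\rangle_\beta=\lim_{N\to\infty}\mathbb E_{\beta,N}[W_\gamma]$. Let $\beta\ge 0$ and let $R\ge 1$ be an integer. For every integer $T\ge1$ and every loop $\gamma_{R,T}$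 in $\mathbb Z^m$ that is the boundary of an axis-parallel rectangle with side lengths $R$ and $T$, the limit $\langle W_{\gamma_{R,T}}\rangle_\beta$ exists. Moreover: 1. If $\beta>0$, then $\langle W_{\gamma_{R,T}}\rangle_\beta>0$ for all such loops, and the limit $$V_\beta(R)=-\lim_{T\to\infty}\frac1T\log\langle W_{\gamma_{R,T}}\rangle_\beta$$ exists as a real number, which does not depend on the positions, coordinate planes and orientations of the rectangles $\gamma_{R,T}$, $T\ge 1$. 2. If $\beta=0$, then $\langle W_{\gamma_{R,T}}\rangle_0=0$ for all such loops, that is, $V_0(R)=+\infty$ with the convention $-\log 0=+\infty$. -/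

import Mathlib

open Filter Topology

noncomputable section

namespace IsingGauge

/-- Vertices of the lattice `ℤ^m`. -/
abbrev Site (m : ℕ) : Type := Fin m → ℤ

/-- The `i`-th unit vector. -/
def unit {m : ℕ} (i : Fin m) : Site m := Pi.single i 1

/-- Positively oriented edges: `(x, i)` is the edge from `x` to `x + unit i`. -/
abbrev Edge (m : ℕ) : Type := Site m × Fin m

/-- Integer `1`-chains on `ℤ^m`: finite formal sums of positively oriented edges. The edge `e` with
the opposite orientation is the chain `-e`. -/
abbrev Chain (m : ℕ) : Type := Edge m →₀ ℤ

/-- The vertices of the box `B_N = [-N, N]^m ∩ ℤ^m`. -/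
def box (m N : ℕ) : Finset (Site m) := Finset.Icc (fun _ => -(N : ℤ)) (fun _ => (N : ℤ))

/-- The positively oriented edges with both endpoints in `B_N`. -/
def boxEdges (m N : ℕ) : Finset (Edge m) :=
  (box m N ×ˢ Finset.univ).filter (fun e => e.1 + unit e.2 ∈ box m N)

/-- The positively oriented plaquettes `(x, i, j)`, `i < j`, with all four corners in `B_N`. -/
def boxPlaquettes (m N : ℕ) : Finset (Site m × Fin m × Fin m) :=
  (box m N ×ˢ Finset.univ).filter (fun p => p.2.1 < p.2.2 ∧
    p.1 + unit p.2.1 ∈ box m N ∧ p.1 + unit p.2.2 ∈ box m N ∧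
    p.1 + unit p.2.1 + unit p.2.2 ∈ box m N)

/-- The oriented boundary of the positively oriented plaquette `(x, i, j)`. -/
def boundary {m : ℕ} (p : Site m × Fin m × Fin m) : Chain m :=
  Finsupp.single (p.1, p.2.1) 1 + Finsupp.single (p.1 + unit p.2.1, p.2.2) 1
    - Finsupp.single (p.1 + unit p.2.2, p.2.1) 1 - Finsupp.single (p.1, p.2.2) 1

/-- Gauge field configurations: `ℤ/2`-valued `1`-forms on `B_N`. Since `σ (-e) = -σ e`, a `1`-form
is given by its values on the positively oriented edges. -/
abbrev GaugeField (m N : ℕ) : Type := {e : Edge m // e ∈ boxEdges m N} → ZMod 2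

/-- The value `σ(γ) = ∑ γ[e] σ(e)` of a gauge field on a `1`-chain (edges outside `B_N` do not
contribute). -/
def GaugeField.eval {m N : ℕ} (σ : GaugeField m N) (γ : Chain m) : ZMod 2 :=
  γ.sum (fun e a => (a : ZMod 2) * (if h : e ∈ boxEdges m N then σ ⟨e, h⟩ else 0))

/-- The representation `g ↦ exp (π i g)` of `ℤ/2`, which takes the real values `1` and `-1`. -/
def rho (g : ZMod 2) : ℝ := (-1) ^ g.val

/-- The Wilson action, a sum over all oriented plaquettes of `B_N`; both orientations
`±p` of each plaquette occur, and `dσ(±p) = σ(±∂p)`. -/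
def action {m N : ℕ} (σ : GaugeField m N) : ℝ :=
  -∑ p ∈ boxPlaquettes m N, (rho (σ.eval (boundary p)) + rho (σ.eval (-boundary p)))

/-- The partition function `Z_{β,N}`. -/
def partitionFunction (m N : ℕ) (β : ℝ) : ℝ :=
  ∑ σ : GaugeField m N, Real.exp (-β * action σ)

/-- The probability `μ_{β,N}(σ)` of a gauge field configuration. -/
def gibbs {m N : ℕ} (β : ℝ) (σ : GaugeField m N) : ℝ :=
  (partitionFunction m N β)⁻¹ * Real.exp (-β * action σ)

/-- The Wilson loop variable `W_γ = ρ(σ(γ))`. -/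
def wilson {m N : ℕ} (γ : Chain m) (σ : GaugeField m N) : ℝ := rho (σ.eval γ)

/-- The finite volume Wilson loop expectation `𝔼_{β,N}[W_γ]` (meaningful when `γ` lies in `B_N`,
which holds for all large `N`). -/
def wilsonExpect {m : ℕ} (N : ℕ) (β : ℝ) (γ : Chain m) : ℝ :=
  ∑ σ : GaugeField m N, gibbs β σ * wilson γ σ

/-- The infinite volume Wilson loop expectation `⟨W_γ⟩_β = lim_{N → ∞} 𝔼_{β,N}[W_γ]`. -/
def wilsonLimit {m : ℕ} (β : ℝ) (γ : Chain m) : ℝ :=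
  limUnder atTop (fun N : ℕ => wilsonExpect N β γ)

/-- The loop around the rectangle with corner `x`, side of length `R` in direction `i` and side of
length `T` in direction `j`. -/
def rectLoop {m : ℕ} (x : Site m) (i j : Fin m) (R T : ℕ) : Chain m :=
  (∑ k ∈ Finset.range R, Finsupp.single (x + k • unit i, i) 1)
    + (∑ k ∈ Finset.range T, Finsupp.single (x + R • unit i + k • unit j, j) 1)
    - (∑ k ∈ Finset.range R, Finsupp.single (x + T • unit j + k • unit i, i) 1)
    - (∑ k ∈ Finset.range T, Finsupp.single (x + k • unit j, j) 1)

/-- `γ` is an axis-parallel rectangular loop with side lengths `R` and `T`, at any position, in any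
coordinate plane, and traversed in either sense. -/
def IsRectLoop {m : ℕ} (R T : ℕ) (γ : Chain m) : Prop :=
  ∃ (x : Site m) (i j : Fin m), i ≠ j ∧ (γ = rectLoop x i j R T ∨ γ = -rectLoop x i j R T)

end IsingGauge

end

namespace IsingGauge

/-! ### Griffiths inequalities -/

/-! Everything rests on Griffiths' inequalities for finite groups of `ZMod 2` fields with
nonnegative couplings. The second one says that an expectation of a product of Wilson variables is
at least the product of the expectations (`wilsonExpect_mul_le`), and that expectations increase
when couplings are added (`corr_div_mono`). Since the boundary conditions are free, enlarging the
box only adds couplings, so finite-volume expectations of a fixed loop increase with `N`, are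
bounded by 1, and converge. Comparing a box with its image inside a larger box gives invariance
under translations and coordinate permutations, so rectangles matter only through their side
lengths.

Two `R`-wide rectangles glued along a side have as sum the long rectangle, the common side
cancelling. Hence minus the log of the expectation is subadditive in `T`, and Fekete's lemma gives
the limit; it is real because expectations are at most 1. Positivity for `β > 0` starts from a
single plaquette and spreads by the same gluing. At `β = 0` the measure is uniform, and a nontrivial
character has mean zero. -/

theorem rho_zero : rho 0 = 1 := by simp [rho]

theorem rho_one : rho 1 = -1 := by simp [rho, ZMod.val_one]

theorem rho_cases (a : ZMod 2) : rho a = 1 ∨ rho a = -1 := by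
  fin_cases a
  · exact Or.inl rho_zero
  · exact Or.inr rho_one

theorem rho_add (a b : ZMod 2) : rho (a + b) = rho a * rho b := by
  have h : ∀ a : ZMod 2, a = 0 ∨ a = 1 := by decide
  have h11 : (1 : ZMod 2) + 1 = 0 := by decide
  rcases h a with rfl | rfl <;> rcases h b with rfl | rfl <;> simp [rho_zero, rho_one, h11]

theorem rho_le_one (a : ZMod 2) : rho a ≤ 1 := by
  rcases rho_cases a with h | h <;> norm_num [h]

theorem neg_one_le_rho (a : ZMod 2) : -1 ≤ rho a := by
  rcases rho_cases a with h | h <;> norm_num [h]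

theorem exp_mul_rho (J : ℝ) (a : ZMod 2) :
    Real.exp (J * rho a) = Real.cosh J + Real.sinh J * rho a := by
  rcases rho_cases a with h | h <;> rw [h]
  · rw [mul_one, mul_one, Real.cosh_add_sinh]
  · rw [mul_neg_one, mul_neg_one, ← sub_eq_add_neg, Real.cosh_sub_sinh]

section Griffiths

variable {G ι : Type*} [AddCommGroup G] [Fintype G]

/-- The unnormalized correlation `∑ σ, ρ(g σ) exp (∑ p ∈ s, J p ρ(f p σ))`. -/
noncomputable def corr (J : ι → ℝ) (f : ι → G →+ ZMod 2) (s : Finset ι) (g : G →+ ZMod 2) : ℝ :=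
  ∑ σ : G, rho (g σ) * Real.exp (∑ p ∈ s, J p * rho (f p σ))

theorem sum_rho_eq_zero {g : G →+ ZMod 2} (hg : g ≠ 0) : ∑ σ : G, rho (g σ) = 0 := by
  obtain ⟨τ, hτ⟩ : ∃ τ, g τ ≠ 0 := by
    by_contra! h
    exact hg (AddMonoidHom.ext h)
  have h1 : g τ = 1 := by
    generalize g τ = a at hτ
    fin_cases a
    · exact absurd rfl hτ
    · rfl
  -- Translating by `τ` permutes the group but flips the sign of every term.
  have h : ∑ σ : G, rho (g (σ + τ)) = ∑ σ : G, rho (g σ) :=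
    Equiv.sum_comp (Equiv.addRight τ) fun σ => rho (g σ)
  simp only [map_add, rho_add, h1, rho_one, mul_neg_one, Finset.sum_neg_distrib] at h
  linarith

theorem sum_rho_nonneg (g : G →+ ZMod 2) : 0 ≤ ∑ σ : G, rho (g σ) := by
  by_cases hg : g = 0
  · subst hg
    simp [rho_zero]
  · rw [sum_rho_eq_zero hg]

/-- High-temperature expansion of a single factor, via `exp_mul_rho`; it drives all the arguments
that add one coupling at a time. -/
theorem corr_cons (J : ι → ℝ) (f : ι → G →+ ZMod 2) {s : Finset ι} {p : ι} (hp : p ∉ s)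
    (g : G →+ ZMod 2) :
    corr J f (Finset.cons p s hp) g
      = Real.cosh (J p) * corr J f s g + Real.sinh (J p) * corr J f s (g + f p) := by
  simp only [corr, Finset.mul_sum, ← Finset.sum_add_distrib]
  refine Finset.sum_congr rfl fun σ _ => ?_
  rw [Finset.sum_cons, Real.exp_add, exp_mul_rho, AddMonoidHom.add_apply, rho_add]
  ring

/-- The first Griffiths inequality. -/
theorem corr_nonneg {J : ι → ℝ} (hJ : ∀ p, 0 ≤ J p) (f : ι → G →+ ZMod 2) (s : Finset ι)
    (g : G →+ ZMod 2) : 0 ≤ corr J f s g := by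
  induction s using Finset.cons_induction generalizing g with
  | empty => simpa [corr] using sum_rho_nonneg g
  | cons p s hp ih =>
    rw [corr_cons]
    exact add_nonneg (mul_nonneg (Real.cosh_pos _).le (ih _))
      (mul_nonneg (Real.sinh_nonneg_iff.2 (hJ p)) (ih _))

theorem corr_zero_pos (J : ι → ℝ) (f : ι → G →+ ZMod 2) (s : Finset ι) : 0 < corr J f s 0 := by
  refine Finset.sum_pos (fun σ _ => ?_) Finset.univ_nonempty
  rw [AddMonoidHom.zero_apply, rho_zero, one_mul]
  exact Real.exp_pos _

theorem corr_le_corr_zero (J : ι → ℝ) (f : ι → G →+ ZMod 2) (s : Finset ι) (g : G →+ ZMod 2) :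
    corr J f s g ≤ corr J f s 0 := by
  refine Finset.sum_le_sum fun σ _ => mul_le_mul_of_nonneg_right ?_ (Real.exp_pos _).le
  rw [AddMonoidHom.zero_apply, rho_zero]
  exact rho_le_one _

/-- The second Griffiths inequality. -/
theorem corr_mul_le {J : ι → ℝ} (hJ : ∀ p, 0 ≤ J p) (f : ι → G →+ ZMod 2) (s : Finset ι)
    (g h : G →+ ZMod 2) : corr J f s g * corr J f s h ≤ corr J f s (g + h) * corr J f s 0 := by
  have shift : ∀ (σ : G) (F : G → ℝ), ∑ τ, F τ = ∑ τ, F (σ + τ) := fun σ F =>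
    (Equiv.sum_comp (Equiv.addLeft σ) F).symm
  -- Duplicate variables: write the second copy of the field as `σ + τ`. For fixed `τ`, the sum over
  -- `σ` is again a correlation, with couplings `J p * (1 + rho (f p τ))`, which are nonnegative, so
  -- the first inequality applies.
  have key : corr J f s (g + h) * corr J f s 0 - corr J f s g * corr J f s h
      = ∑ τ : G, (1 - rho (h τ)) * corr (fun p => J p * (1 + rho (f p τ))) f s (g + h) := by
    unfold corr
    simp only [Finset.sum_mul_sum, ← Finset.sum_sub_distrib]
    simp only [Finset.mul_sum]
    conv_rhs => rw [Finset.sum_comm]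
    refine Finset.sum_congr rfl fun σ _ => ?_
    rw [shift σ]
    refine Finset.sum_congr rfl fun τ _ => ?_
    have e : ∑ p ∈ s, J p * (1 + rho (f p τ)) * rho (f p σ)
        = ∑ p ∈ s, J p * rho (f p σ) + ∑ p ∈ s, J p * rho (f p (σ + τ)) := by
      rw [← Finset.sum_add_distrib]
      refine Finset.sum_congr rfl fun p _ => ?_
      rw [map_add, rho_add]
      ring
    rw [e, Real.exp_add]
    simp only [AddMonoidHom.add_apply, AddMonoidHom.zero_apply, rho_zero, map_add, rho_add]
    ring
  rw [← sub_nonneg, key]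
  refine Finset.sum_nonneg fun τ _ => mul_nonneg (sub_nonneg.2 (rho_le_one _))
    (corr_nonneg (fun p => mul_nonneg (hJ p) ?_) f s _)
  linarith [neg_one_le_rho (f p τ)]

/-- After one coupling is split off and the fractions are cross-multiplied, the `cosh` terms cancel
and `sinh (J p)` times the second Griffiths inequality remains. -/
theorem corr_div_mono {J : ι → ℝ} (hJ : ∀ p, 0 ≤ J p) (f : ι → G →+ ZMod 2) {s t : Finset ι}
    (hst : s ⊆ t) (g : G →+ ZMod 2) :
    corr J f s g / corr J f s 0 ≤ corr J f t g / corr J f t 0 := by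
  classical
  suffices H : ∀ u : Finset ι,
      corr J f s g / corr J f s 0 ≤ corr J f (s ∪ u) g / corr J f (s ∪ u) 0 by
    simpa only [Finset.union_eq_right.2 hst] using H t
  intro u
  induction u using Finset.induction_on with
  | empty => rw [Finset.union_empty]
  | insert p u _ ih =>
    refine ih.trans ?_
    rw [Finset.union_insert]
    by_cases hp : p ∈ s ∪ u
    · rw [Finset.insert_eq_of_mem hp]
    · rw [div_le_div_iff₀ (corr_zero_pos J f _) (corr_zero_pos J f _), ← Finset.cons_eq_insert _ _ hp,
        corr_cons, corr_cons, zero_add]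
      have h := mul_le_mul_of_nonneg_left (corr_mul_le hJ f (s ∪ u) g (f p))
        (Real.sinh_nonneg_iff.2 (hJ p))
      linarith

/-- Splitting off `p` itself produces the term `sinh (J p) * corr J f _ 0`, because `f p + f p = 0`
modulo 2. -/
theorem corr_pos {J : ι → ℝ} (hJ : ∀ p, 0 ≤ J p) (f : ι → G →+ ZMod 2) {s : Finset ι} {p : ι}
    (hp : p ∈ s) (hJp : 0 < J p) : 0 < corr J f s (f p) := by
  classical
  have hf : f p + f p = 0 := by
    ext σ
    rw [AddMonoidHom.add_apply, CharTwo.add_self_eq_zero, AddMonoidHom.zero_apply]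
  rw [← Finset.insert_erase hp, ← Finset.cons_eq_insert _ _ (Finset.notMem_erase p s), corr_cons,
    hf]
  exact add_pos_of_nonneg_of_pos (mul_nonneg (Real.cosh_pos _).le (corr_nonneg hJ f _ _))
    (mul_pos (Real.sinh_pos_iff.2 hJp) (corr_zero_pos J f _))

/-- Normalized correlations are unchanged when the group is enlarged. -/
theorem corr_div_eq_of_surjective {H κ : Type*} [AddCommGroup H] [Fintype H] [DecidableEq κ]
    (r : H →+ G) (hr : Function.Surjective r) {J : ι → ℝ} {J' : κ → ℝ} {f : ι → G →+ ZMod 2}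
    {f' : κ → H →+ ZMod 2} {s : Finset ι} (φ : ι → κ) (hφ : Set.InjOn φ s)
    (hJ : ∀ p ∈ s, J' (φ p) = J p) (hf : ∀ p ∈ s, f' (φ p) = (f p).comp r) (g : G →+ ZMod 2) :
    corr J' f' (s.image φ) (g.comp r) / corr J' f' (s.image φ) 0
      = corr J f s g / corr J f s 0 := by
  classical
  have hc : (Finset.univ.filter fun σ => r σ = 0).card ≠ 0 :=
    Finset.card_ne_zero_of_mem (a := 0) (by simp)
  have hsum (g : G →+ ZMod 2) : corr J' f' (s.image φ) (g.comp r)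
      = (Finset.univ.filter fun σ => r σ = 0).card * corr J f s g := by
    unfold corr
    -- The weight is constant on the fibres of `r`, all of which have the size of the kernel; this
    -- factor cancels in the quotient.
    rw [← Finset.sum_fiberwise (g := r), Finset.mul_sum]
    refine Finset.sum_congr rfl fun τ _ => ?_
    rw [← AddMonoidHom.card_fiber_eq_of_mem_range r (hr τ) (hr 0), ← nsmul_eq_mul]
    refine Finset.sum_eq_card_nsmul fun σ hσ => ?_
    rw [Finset.sum_image hφ, ← (Finset.mem_filter.1 hσ).2]
    congr 2
    exact Finset.sum_congr rfl fun p hp => by rw [hJ p hp, hf p hp]; rfl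
  have h0 := hsum 0
  rw [AddMonoidHom.zero_comp] at h0
  rw [hsum, h0, mul_div_mul_left _ _ (Nat.cast_ne_zero.2 hc)]

end Griffiths

end IsingGauge

namespace IsingGauge

/-! ### Gauge fields and Wilson loop expectations -/

variable {m N : ℕ}

theorem GaugeField.eval_add_chain (σ : GaugeField m N) (γ γ' : Chain m) :
    σ.eval (γ + γ') = σ.eval γ + σ.eval γ' :=
  Finsupp.sum_add_index' (fun _ => by simp) fun _ _ _ => by push_cast; ring

theorem GaugeField.eval_zero_chain (σ : GaugeField m N) : σ.eval 0 = 0 := Finsupp.sum_zero_index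

theorem GaugeField.eval_neg_chain (σ : GaugeField m N) (γ : Chain m) :
    σ.eval (-γ) = σ.eval γ := by
  have h := σ.eval_add_chain (-γ) γ
  rw [neg_add_cancel, eval_zero_chain] at h
  rw [eq_neg_of_add_eq_zero_left h.symm, CharTwo.neg_eq]

/-- Evaluation at a chain, as a homomorphism. -/
noncomputable def evalHom (γ : Chain m) : GaugeField m N →+ ZMod 2 where
  toFun σ := σ.eval γ
  map_zero' := by simp [GaugeField.eval]
  map_add' σ τ := by
    simp only [GaugeField.eval, Finsupp.sum, ← Finset.sum_add_distrib]
    refine Finset.sum_congr rfl fun e _ => ?_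
    split_ifs
    · rw [Pi.add_apply, mul_add]
    · simp

theorem evalHom_apply (γ : Chain m) (σ : GaugeField m N) : evalHom γ σ = σ.eval γ := rfl

theorem evalHom_add (γ γ' : Chain m) :
    (evalHom (γ + γ') : GaugeField m N →+ ZMod 2) = evalHom γ + evalHom γ' :=
  AddMonoidHom.ext fun σ => σ.eval_add_chain γ γ'

theorem evalHom_neg (γ : Chain m) : (evalHom (-γ) : GaugeField m N →+ ZMod 2) = evalHom γ :=
  AddMonoidHom.ext fun σ => σ.eval_neg_chain γ

theorem evalHom_zero : (evalHom 0 : GaugeField m N →+ ZMod 2) = 0 :=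
  AddMonoidHom.ext fun σ => σ.eval_zero_chain

theorem exp_neg_mul_action (β : ℝ) (σ : GaugeField m N) : Real.exp (-β * action σ)
    = Real.exp (∑ p ∈ boxPlaquettes m N, 2 * β * rho (evalHom (boundary p) σ)) := by
  simp only [action, GaugeField.eval_neg_chain, evalHom_apply, neg_mul_neg, Finset.mul_sum]
  congr 1
  exact Finset.sum_congr rfl fun p _ => by ring

theorem wilsonExpect_eq_corr (N : ℕ) (β : ℝ) (γ : Chain m) : wilsonExpect N β γ
    = corr (G := GaugeField m N) (fun _ => 2 * β) (fun p => evalHom (boundary p))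
        (boxPlaquettes m N) (evalHom γ)
      / corr (G := GaugeField m N) (fun _ => 2 * β) (fun p => evalHom (boundary p))
        (boxPlaquettes m N) 0 := by
  simp only [wilsonExpect, gibbs, partitionFunction, wilson, corr, exp_neg_mul_action,
    AddMonoidHom.zero_apply, rho_zero, one_mul, evalHom_apply, div_eq_inv_mul, Finset.mul_sum]
  refine Finset.sum_congr rfl fun σ _ => ?_
  ring

theorem wilsonExpect_neg (N : ℕ) (β : ℝ) (γ : Chain m) :
    wilsonExpect N β (-γ) = wilsonExpect N β γ := by
  rw [wilsonExpect_eq_corr, wilsonExpect_eq_corr, evalHom_neg]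

theorem wilsonExpect_zero (N : ℕ) (β : ℝ) : wilsonExpect N β (0 : Chain m) = 1 := by
  rw [wilsonExpect_eq_corr, evalHom_zero]
  exact div_self (corr_zero_pos _ _ _).ne'

theorem wilsonExpect_le_one (N : ℕ) (β : ℝ) (γ : Chain m) : wilsonExpect N β γ ≤ 1 := by
  rw [wilsonExpect_eq_corr]
  exact div_le_one_of_le₀ (corr_le_corr_zero _ _ _ _) (corr_zero_pos _ _ _).le

theorem wilsonExpect_mul_le (N : ℕ) {β : ℝ} (hβ : 0 ≤ β) (γ γ' : Chain m) :
    wilsonExpect N β γ * wilsonExpect N β γ' ≤ wilsonExpect N β (γ + γ') := by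
  have h0 := corr_zero_pos (G := GaugeField m N) (fun _ => 2 * β)
    (fun p => evalHom (boundary p)) (boxPlaquettes m N)
  simp only [wilsonExpect_eq_corr, evalHom_add]
  rw [div_mul_div_comm, div_le_div_iff₀ (mul_pos h0 h0) h0, ← mul_assoc]
  exact mul_le_mul_of_nonneg_right (corr_mul_le (fun _ => by positivity) _ _ _ _) h0.le

theorem wilsonExpect_boundary_pos {β : ℝ} (hβ : 0 < β) {p : Site m × Fin m × Fin m}
    (hp : p ∈ boxPlaquettes m N) : 0 < wilsonExpect N β (boundary p) := by
  rw [wilsonExpect_eq_corr]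
  exact div_pos (corr_pos (f := fun p => evalHom (boundary p)) (fun _ => by positivity) hp
    (by positivity)) (corr_zero_pos _ _ _)

theorem wilsonExpect_zero_coupling {γ : Chain m} {e : Edge m} (he : e ∈ boxEdges m N)
    (hγ : ((γ e : ℤ) : ZMod 2) ≠ 0) : wilsonExpect N 0 γ = 0 := by
  have h : (evalHom γ : GaugeField m N →+ ZMod 2) ≠ 0 := by
    intro h
    -- The field supported on the single edge `e` detects the odd coefficient of `γ` there.
    have h1 := DFunLike.congr_fun h (Pi.single ⟨e, he⟩ 1)
    rw [evalHom_apply, GaugeField.eval, Finsupp.sum,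
      Finset.sum_eq_single_of_mem e (Finsupp.mem_support_iff.2 fun h0 => hγ (by simp [h0]))] at h1
    · simp [he] at h1
      exact hγ h1
    · intro b _ hb
      split_ifs
      · rw [Pi.single_eq_of_ne (by simpa using hb), mul_zero]
      · rw [mul_zero]
  rw [wilsonExpect_eq_corr]
  simp [corr, sum_rho_eq_zero h]

/-! ### Lattice symmetries -/

/-- The lattice symmetry permuting the coordinates by `π` and translating by `v`. -/
def siteMap (π : Equiv.Perm (Fin m)) (v x : Site m) : Site m := fun k => x (π.symm k) + v k

/-- The action of a lattice symmetry on edges. -/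
def edgeMap (π : Equiv.Perm (Fin m)) (v : Site m) (e : Edge m) : Edge m :=
  (siteMap π v e.1, π e.2)

/-- The action of a lattice symmetry on plaquettes. -/
def plaquetteMap (π : Equiv.Perm (Fin m)) (v : Site m) (p : Site m × Fin m × Fin m) :
    Site m × Fin m × Fin m :=
  if π p.2.1 < π p.2.2 then (siteMap π v p.1, π p.2.1, π p.2.2)
  else (siteMap π v p.1, π p.2.2, π p.2.1)

variable (π : Equiv.Perm (Fin m)) (v : Site m)

theorem siteMap_injective : Function.Injective (siteMap π v) := by
  intro x y h
  funext k
  simpa [siteMap] using congrFun h (π k)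

theorem edgeMap_injective : Function.Injective (edgeMap π v) := by
  rintro ⟨x, i⟩ ⟨y, j⟩ h
  simp only [edgeMap, Prod.mk.injEq] at h
  rw [siteMap_injective π v h.1, π.injective h.2]

theorem siteMap_add_unit (x : Site m) (i : Fin m) :
    siteMap π v (x + unit i) = siteMap π v x + unit (π i) := by
  funext k
  simp only [siteMap, unit, Pi.add_apply, Pi.single_apply, Equiv.symm_apply_eq]
  ring

theorem siteMap_add_nsmul_unit (x : Site m) (n : ℕ) (i : Fin m) :
    siteMap π v (x + n • unit i) = siteMap π v x + n • unit (π i) := by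
  induction n with
  | zero => simp
  | succ n ih => rw [succ_nsmul, ← add_assoc, siteMap_add_unit, ih, succ_nsmul, add_assoc]

theorem boundary_swap (x : Site m) (i j : Fin m) : boundary (x, j, i) = -boundary (x, i, j) := by
  simp only [boundary]
  abel

theorem mapDomain_boundary (p : Site m × Fin m × Fin m) :
    (boundary p).mapDomain (edgeMap π v)
      = boundary (siteMap π v p.1, π p.2.1, π p.2.2) := by
  rw [← Finsupp.lmapDomain_apply ℤ ℤ]
  simp only [boundary, map_add, map_sub, Finsupp.lmapDomain_apply, Finsupp.mapDomain_single,
    edgeMap, siteMap_add_unit]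

/-- Sorting the two directions may reverse the orientation, but signs are invisible modulo 2. -/
theorem evalHom_boundary_plaquetteMap (p : Site m × Fin m × Fin m) :
    (evalHom (boundary (plaquetteMap π v p)) : GaugeField m N →+ ZMod 2)
      = evalHom ((boundary p).mapDomain (edgeMap π v)) := by
  rw [mapDomain_boundary, plaquetteMap]
  split_ifs
  · rfl
  · rw [boundary_swap, evalHom_neg]

theorem mapDomain_rectLoop (x : Site m) (i j : Fin m) (R T : ℕ) :
    (rectLoop x i j R T).mapDomain (edgeMap π v)
      = rectLoop (siteMap π v x) (π i) (π j) R T := by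
  rw [← Finsupp.lmapDomain_apply ℤ ℤ]
  simp only [rectLoop, map_add, map_sub, map_sum, Finsupp.lmapDomain_apply,
    Finsupp.mapDomain_single, edgeMap, siteMap_add_nsmul_unit]

theorem siteMap_mem_box {N M : ℕ} (hM : ∀ k, N + (v k).natAbs ≤ M) {x : Site m}
    (hx : x ∈ box m N) : siteMap π v x ∈ box m M := by
  simp only [box, Finset.mem_Icc, Pi.le_def, siteMap] at hx ⊢
  refine ⟨fun k => ?_, fun k => ?_⟩ <;>
  · have h1 := hx.1 (π.symm k)
    have h2 := hx.2 (π.symm k)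
    have h3 := hM k
    omega

theorem edgeMap_mem_boxEdges {N M : ℕ} (hM : ∀ k, N + (v k).natAbs ≤ M) {e : Edge m}
    (he : e ∈ boxEdges m N) : edgeMap π v e ∈ boxEdges m M := by
  simp only [boxEdges, Finset.mem_filter, Finset.mem_product, Finset.mem_univ, and_true, edgeMap,
    ← siteMap_add_unit] at he ⊢
  exact ⟨siteMap_mem_box π v hM he.1, siteMap_mem_box π v hM he.2⟩

theorem plaquetteMap_mem_boxPlaquettes {N M : ℕ} (hM : ∀ k, N + (v k).natAbs ≤ M)
    {p : Site m × Fin m × Fin m} (hp : p ∈ boxPlaquettes m N) :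
    plaquetteMap π v p ∈ boxPlaquettes m M := by
  simp only [boxPlaquettes, Finset.mem_filter, Finset.mem_product, Finset.mem_univ, and_true]
    at hp ⊢
  obtain ⟨h0, hlt, h1, h2, h3⟩ := hp
  have h3' : p.1 + unit p.2.2 + unit p.2.1 ∈ box m N := by rwa [add_right_comm]
  have hne : π p.2.1 ≠ π p.2.2 := π.injective.ne hlt.ne
  unfold plaquetteMap
  split_ifs with h <;> simp only [← siteMap_add_unit]
  · exact ⟨siteMap_mem_box π v hM h0, h, siteMap_mem_box π v hM h1, siteMap_mem_box π v hM h2,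
      siteMap_mem_box π v hM h3⟩
  · exact ⟨siteMap_mem_box π v hM h0, lt_of_le_of_ne (not_lt.1 h) hne.symm,
      siteMap_mem_box π v hM h2, siteMap_mem_box π v hM h1, siteMap_mem_box π v hM h3'⟩

theorem plaquetteMap_injOn : Set.InjOn (plaquetteMap π v) (boxPlaquettes m N) := by
  rintro ⟨x, i, j⟩ hp ⟨y, k, l⟩ hq h
  have hp' : i < j := (Finset.mem_filter.1 hp).2.1
  have hq' : k < l := (Finset.mem_filter.1 hq).2.1
  unfold plaquetteMap at h
  split_ifs at h <;> simp only [Prod.mk.injEq, π.injective.eq_iff] at h <;>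
    obtain ⟨h1, h2, h3⟩ := h <;> rw [siteMap_injective π v h1]
  · rw [h2, h3]
  · exact absurd hp' (by rw [h2, h3]; exact hq'.asymm)
  · exact absurd hp' (by rw [h2, h3]; exact hq'.asymm)
  · rw [h2, h3]

theorem boundary_mem_supported {p : Site m × Fin m × Fin m} (hp : p ∈ boxPlaquettes m N) :
    boundary p ∈ Finsupp.supported ℤ ℤ (boxEdges m N : Set (Edge m)) := by
  simp only [boxPlaquettes, Finset.mem_filter, Finset.mem_product, Finset.mem_univ, and_true]
    at hp
  obtain ⟨h0, -, h1, h2, h3⟩ := hp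
  have h3' : p.1 + unit p.2.2 + unit p.2.1 ∈ box m N := by rwa [add_right_comm]
  refine Submodule.sub_mem _ (Submodule.sub_mem _ (Submodule.add_mem _ ?_ ?_) ?_) ?_ <;>
  · refine Finsupp.single_mem_supported ℤ 1 ?_
    simp [boxEdges, *]

/-- The pullback of a gauge field by a lattice symmetry. -/
def pullback {N M : ℕ} (hM : ∀ k, N + (v k).natAbs ≤ M) : GaugeField m M →+ GaugeField m N where
  toFun σ e := σ ⟨edgeMap π v e, edgeMap_mem_boxEdges π v hM e.2⟩
  map_zero' := rfl
  map_add' _ _ := rfl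

theorem pullback_surjective {N M : ℕ} (hM : ∀ k, N + (v k).natAbs ≤ M) :
    Function.Surjective (pullback π v hM) := by
  have hinj : Function.Injective (fun e : {e : Edge m // e ∈ boxEdges m N} =>
      (⟨edgeMap π v e, edgeMap_mem_boxEdges π v hM e.2⟩ : {e : Edge m // e ∈ boxEdges m M})) :=
    fun a b h => Subtype.ext (edgeMap_injective π v (Subtype.ext_iff.1 h))
  exact hinj.surjective_comp_right

theorem evalHom_comp_pullback {N M : ℕ} (hM : ∀ k, N + (v k).natAbs ≤ M) {γ : Chain m}
    (hγ : γ ∈ Finsupp.supported ℤ ℤ (boxEdges m N : Set (Edge m))) :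
    (evalHom γ).comp (pullback π v hM) = evalHom (γ.mapDomain (edgeMap π v)) := by
  refine AddMonoidHom.ext fun σ => ?_
  simp only [AddMonoidHom.comp_apply, evalHom_apply, GaugeField.eval]
  rw [Finsupp.sum_mapDomain_index (fun _ => by simp) (fun _ _ _ => by push_cast; ring)]
  refine Finset.sum_congr rfl fun e he => ?_
  have he' : e ∈ boxEdges m N := hγ he
  beta_reduce
  rw [dif_pos he', dif_pos (edgeMap_mem_boxEdges π v hM he')]
  rfl

/-- The model on `B_N` is the model on `B_M` with couplings kept only on the image plaquettes;
restoring the others raises the expectation. This single inequality yields both monotonicity in the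
volume and lattice invariance. -/
theorem wilsonExpect_le_mapDomain {N M : ℕ} (hM : ∀ k, N + (v k).natAbs ≤ M) {β : ℝ} (hβ : 0 ≤ β)
    {γ : Chain m} (hγ : γ ∈ Finsupp.supported ℤ ℤ (boxEdges m N : Set (Edge m))) :
    wilsonExpect N β γ ≤ wilsonExpect M β (γ.mapDomain (edgeMap π v)) := by
  classical
  rw [wilsonExpect_eq_corr, wilsonExpect_eq_corr, ← evalHom_comp_pullback π v hM hγ,
    ← corr_div_eq_of_surjective (pullback π v hM) (pullback_surjective π v hM)
      (J' := fun _ => 2 * β) (f' := fun p => evalHom (boundary p)) (plaquetteMap π v)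
      (plaquetteMap_injOn π v) (fun _ _ => rfl) (fun p hp => ?_)]
  · exact corr_div_mono (fun _ => by positivity) _
      (Finset.image_subset_iff.2 fun p hp => plaquetteMap_mem_boxPlaquettes π v hM hp) _
  · rw [evalHom_boundary_plaquetteMap, evalHom_comp_pullback π v hM (boundary_mem_supported hp)]

/-! ### The infinite volume limit -/

theorem eventually_mem_boxEdges (e : Edge m) : ∀ᶠ N in atTop, e ∈ boxEdges m N := by
  have hbox (x : Site m) : ∀ᶠ N in atTop, x ∈ box m N := by
    have h : ∀ᶠ N : ℕ in atTop, ∀ k, (x k).natAbs ≤ N :=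
      eventually_all.2 fun k => eventually_ge_atTop _
    filter_upwards [h] with N hN
    simp only [box, Finset.mem_Icc, Pi.le_def]
    refine ⟨fun k => ?_, fun k => ?_⟩ <;>
    · have := hN k
      omega
  filter_upwards [hbox e.1, hbox (e.1 + unit e.2)] with N h1 h2
  simp [boxEdges, h1, h2]

theorem eventually_mem_supported (γ : Chain m) :
    ∀ᶠ N in atTop, γ ∈ Finsupp.supported ℤ ℤ (boxEdges m N : Set (Edge m)) := by
  filter_upwards [(eventually_all_finset γ.support).2 fun e _ => eventually_mem_boxEdges e]
    with N hN e he using hN e he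

theorem edgeMap_one_zero : edgeMap (1 : Equiv.Perm (Fin m)) 0 = id :=
  funext fun e => Prod.ext (funext fun k => add_zero (e.1 k)) rfl

theorem wilsonExpect_mono {N M : ℕ} (hM : N ≤ M) {β : ℝ} (hβ : 0 ≤ β) {γ : Chain m}
    (hγ : γ ∈ Finsupp.supported ℤ ℤ (boxEdges m N : Set (Edge m))) :
    wilsonExpect N β γ ≤ wilsonExpect M β γ := by
  simpa [edgeMap_one_zero] using
    wilsonExpect_le_mapDomain 1 0 (fun _ => by simpa using hM) hβ hγ

theorem tendsto_wilsonExpect {β : ℝ} (hβ : 0 ≤ β) (γ : Chain m) :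
    Tendsto (fun N : ℕ => wilsonExpect N β γ) atTop (𝓝 (wilsonLimit β γ)) := by
  obtain ⟨N₀, hN₀⟩ := eventually_atTop.1 (eventually_mem_supported γ)
  -- Monotonicity is available only once the box contains the support of `γ`, hence the shift by
  -- `N₀`.
  have hmono : Monotone fun N => wilsonExpect (N + N₀) β γ := fun a b hab =>
    wilsonExpect_mono (by omega) hβ (hN₀ _ (by omega))
  refine tendsto_nhds_limUnder ⟨_, (tendsto_add_atTop_iff_nat N₀).1
    (tendsto_atTop_ciSup hmono ⟨1, ?_⟩)⟩
  rintro _ ⟨N, rfl⟩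
  exact wilsonExpect_le_one _ _ _

end IsingGauge

namespace IsingGauge

/-! ### Infinite-volume expectations -/

variable {m : ℕ} {β : ℝ}

theorem wilsonLimit_le_one (hβ : 0 ≤ β) (γ : Chain m) : wilsonLimit β γ ≤ 1 :=
  le_of_tendsto' (tendsto_wilsonExpect hβ γ) fun N => wilsonExpect_le_one N β γ

theorem wilsonLimit_neg (β : ℝ) (γ : Chain m) : wilsonLimit β (-γ) = wilsonLimit β γ := by
  simp only [wilsonLimit, wilsonExpect_neg]

theorem wilsonLimit_zero (hβ : 0 ≤ β) : wilsonLimit β (0 : Chain m) = 1 :=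
  tendsto_nhds_unique (tendsto_wilsonExpect hβ 0) (by simp [wilsonExpect_zero])

theorem wilsonLimit_mul_le (hβ : 0 ≤ β) (γ γ' : Chain m) :
    wilsonLimit β γ * wilsonLimit β γ' ≤ wilsonLimit β (γ + γ') :=
  le_of_tendsto_of_tendsto' ((tendsto_wilsonExpect hβ γ).mul (tendsto_wilsonExpect hβ γ'))
    (tendsto_wilsonExpect hβ _) fun N => wilsonExpect_mul_le N hβ γ γ'

theorem wilsonLimit_le_mapDomain (hβ : 0 ≤ β) (π : Equiv.Perm (Fin m)) (v : Site m)
    (γ : Chain m) : wilsonLimit β γ ≤ wilsonLimit β (γ.mapDomain (edgeMap π v)) := by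
  have hshift := tendsto_add_atTop_nat (∑ k, (v k).natAbs)
  refine le_of_tendsto_of_tendsto (tendsto_wilsonExpect hβ γ)
    ((tendsto_wilsonExpect hβ _).comp hshift) ?_
  filter_upwards [eventually_mem_supported γ] with N hN
  refine wilsonExpect_le_mapDomain π v (fun k => Nat.add_le_add_left ?_ N) hβ hN
  exact Finset.single_le_sum (f := fun k => (v k).natAbs) (fun _ _ => Nat.zero_le _)
    (Finset.mem_univ k)

theorem wilsonLimit_boundary_pos (hβ : 0 < β) (x : Site m) {i j : Fin m} (hij : i < j) :
    0 < wilsonLimit β (boundary (x, i, j)) := by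
  -- The three edges placed in the box already account for all four corners of the plaquette.
  obtain ⟨N, h1, h2, hN⟩ := ((eventually_mem_boxEdges (x, i)).and
    ((eventually_mem_boxEdges (x + unit i, j)).and
      ((eventually_mem_boxEdges (x, j)).and
        (eventually_mem_supported (boundary (x, i, j)))))).exists
  obtain ⟨h3, hN⟩ := hN
  simp only [boxEdges, Finset.mem_filter, Finset.mem_product, Finset.mem_univ, and_true]
    at h1 h2 h3
  have hp : (x, i, j) ∈ boxPlaquettes m N := by
    simp only [boxPlaquettes, Finset.mem_filter, Finset.mem_product, Finset.mem_univ, and_true]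
    exact ⟨h1.1, hij, h1.2, h3.2, h2.2⟩
  refine (wilsonExpect_boundary_pos hβ hp).trans_le
    (ge_of_tendsto (tendsto_wilsonExpect hβ.le _) ?_)
  filter_upwards [eventually_ge_atTop N] with M hM using wilsonExpect_mono hM hβ.le hN

/-! ### Rectangular loops -/

theorem rectLoop_one_one (x : Site m) (i j : Fin m) :
    rectLoop x i j 1 1 = boundary (x, i, j) := by
  simp [rectLoop, boundary]

theorem rectLoop_zero (x : Site m) (i j : Fin m) (R : ℕ) : rectLoop x i j R 0 = 0 := by
  simp [rectLoop]

theorem rectLoop_swap (x : Site m) (i j : Fin m) (R T : ℕ) :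
    rectLoop x j i T R = -rectLoop x i j R T := by
  simp only [rectLoop]
  abel

/-- The common side is traversed in opposite senses and cancels. -/
theorem rectLoop_add (x : Site m) (i j : Fin m) (R S T : ℕ) :
    rectLoop x i j R (S + T) = rectLoop x i j R S + rectLoop (x + S • unit j) i j R T := by
  simp only [rectLoop, Finset.sum_range_add, add_nsmul, add_right_comm x (S • unit j : Site m),
    add_assoc]
  abel_nf

/-- Exhibits an odd coefficient, so that the loop is a nontrivial character of the gauge fields. -/
theorem rectLoop_apply_corner (x : Site m) {i j : Fin m} (hij : i ≠ j) {R T : ℕ} (hR : 1 ≤ R)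
    (hT : 1 ≤ T) : rectLoop x i j R T (x, i) = 1 := by
  have h1 : ∑ k ∈ Finset.range R, (Finsupp.single (x + k • unit i, i) 1 : Chain m) (x, i) = 1 := by
    rw [Finset.sum_eq_single_of_mem 0 (Finset.mem_range.2 hR)]
    · simp
    · intro k _ hk
      refine Finsupp.single_eq_of_ne fun h => hk ?_
      have := congrFun (congrArg Prod.fst h) i
      simpa [unit] using this
  have h2 : ∑ k ∈ Finset.range R,
      (Finsupp.single (x + T • unit j + k • unit i, i) 1 : Chain m) (x, i) = 0 := by
    refine Finset.sum_eq_zero fun k _ => Finsupp.single_eq_of_ne fun h => ?_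
    have := congrFun (congrArg Prod.fst h) j
    simp [unit, hij] at this
    omega
  have h3 (n : ℕ) (y : ℕ → Site m) :
      ∑ k ∈ Finset.range n, (Finsupp.single (y k, j) 1 : Chain m) (x, i) = 0 :=
    Finset.sum_eq_zero fun k _ => Finsupp.single_eq_of_ne fun h => hij (congrArg Prod.snd h)
  simp only [rectLoop, Finsupp.sub_apply, Finsupp.add_apply, Finsupp.finsetSum_apply, h1, h2, h3]
  norm_num

theorem exists_perm_apply_eq {i j i' j' : Fin m} (h : i ≠ j) (h' : i' ≠ j') :
    ∃ π : Equiv.Perm (Fin m), π i = i' ∧ π j = j' := by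
  refine ⟨Equiv.swap (Equiv.swap i i' j) j' * Equiv.swap i i', ?_, ?_⟩
  · rw [Equiv.Perm.mul_apply, Equiv.swap_apply_left, Equiv.swap_apply_of_ne_of_ne _ h']
    intro h1
    rw [← Equiv.swap_apply_left i i'] at h1
    exact h ((Equiv.swap i i').injective (by simpa using h1))
  · rw [Equiv.Perm.mul_apply, Equiv.swap_apply_left]

/-- Some lattice symmetry carries one rectangle to the other; an inequality suffices, since the
roles can be exchanged. -/
theorem wilsonLimit_rectLoop_le (hβ : 0 ≤ β) (x x' : Site m) {i j i' j' : Fin m} (h : i ≠ j)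
    (h' : i' ≠ j') (R T : ℕ) :
    wilsonLimit β (rectLoop x i j R T) ≤ wilsonLimit β (rectLoop x' i' j' R T) := by
  obtain ⟨π, rfl, rfl⟩ := exists_perm_apply_eq h h'
  have hx : siteMap π (fun k => x' k - x (π.symm k)) x = x' := by
    funext k
    simp [siteMap]
  have := wilsonLimit_le_mapDomain hβ π (fun k => x' k - x (π.symm k)) (rectLoop x i j R T)
  rwa [mapDomain_rectLoop, hx] at this

/-- The infinite volume expectation depends only on the side lengths of the rectangle. -/
theorem wilsonLimit_rectLoop_eq (hβ : 0 ≤ β) (x x' : Site m) {i j i' j' : Fin m} (h : i ≠ j)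
    (h' : i' ≠ j') (R T : ℕ) :
    wilsonLimit β (rectLoop x i j R T) = wilsonLimit β (rectLoop x' i' j' R T) :=
  (wilsonLimit_rectLoop_le hβ x x' h h' R T).antisymm (wilsonLimit_rectLoop_le hβ x' x h' h R T)

theorem IsRectLoop.wilsonLimit_eq (hβ : 0 ≤ β) {R T : ℕ} {γ : Chain m} (hγ : IsRectLoop R T γ)
    (x : Site m) {i j : Fin m} (h : i ≠ j) :
    wilsonLimit β γ = wilsonLimit β (rectLoop x i j R T) := by
  obtain ⟨y, k, l, hkl, rfl | rfl⟩ := hγ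
  · exact wilsonLimit_rectLoop_eq hβ y x hkl h R T
  · rw [wilsonLimit_neg]
    exact wilsonLimit_rectLoop_eq hβ y x hkl h R T

theorem wilsonLimit_rectLoop_mul_le (hβ : 0 ≤ β) (x : Site m) {i j : Fin m} (h : i ≠ j)
    (R S T : ℕ) : wilsonLimit β (rectLoop x i j R S) * wilsonLimit β (rectLoop x i j R T)
      ≤ wilsonLimit β (rectLoop x i j R (S + T)) := by
  rw [rectLoop_add, wilsonLimit_rectLoop_eq hβ x (x + S • unit j) h h R T]
  exact wilsonLimit_mul_le hβ _ _

theorem wilsonLimit_rectLoop_swap (β : ℝ) (x : Site m) (i j : Fin m) (R T : ℕ) :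
    wilsonLimit β (rectLoop x j i T R) = wilsonLimit β (rectLoop x i j R T) := by
  rw [rectLoop_swap, wilsonLimit_neg]

theorem wilsonLimit_rectLoop_pos_of_one (hβ : 0 ≤ β) (x : Site m) {i j : Fin m} (h : i ≠ j)
    {R : ℕ} (h1 : 0 < wilsonLimit β (rectLoop x i j R 1)) (T : ℕ) :
    0 < wilsonLimit β (rectLoop x i j R T) := by
  induction T with
  | zero =>
    rw [rectLoop_zero, wilsonLimit_zero hβ]
    exact one_pos
  | succ T ih => exact (mul_pos ih h1).trans_le (wilsonLimit_rectLoop_mul_le hβ x h R T 1)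

/-- Plaquettes are glued into a strip of length `R`, and after exchanging the sides `T` such strips
are glued together. -/
theorem wilsonLimit_rectLoop_pos (hβ : 0 < β) (x : Site m) {i j : Fin m} (h : i ≠ j)
    (R T : ℕ) : 0 < wilsonLimit β (rectLoop x i j R T) := by
  have h11 : 0 < wilsonLimit β (rectLoop x j i 1 1) := by
    rcases h.lt_or_gt with hlt | hlt
    · rw [wilsonLimit_rectLoop_swap, rectLoop_one_one]
      exact wilsonLimit_boundary_pos hβ x hlt
    · rw [rectLoop_one_one]
      exact wilsonLimit_boundary_pos hβ x hlt
  refine wilsonLimit_rectLoop_pos_of_one hβ.le x h ?_ T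
  rw [← wilsonLimit_rectLoop_swap]
  exact wilsonLimit_rectLoop_pos_of_one hβ.le x h.symm h11 R

theorem subadditive_neg_log_wilsonLimit (hβ : 0 < β) (x : Site m) {i j : Fin m} (h : i ≠ j)
    (R : ℕ) : Subadditive fun T => -Real.log (wilsonLimit β (rectLoop x i j R T)) := by
  intro S T
  have hS := wilsonLimit_rectLoop_pos hβ x h R S
  have hT := wilsonLimit_rectLoop_pos hβ x h R T
  rw [← neg_add, ← Real.log_mul hS.ne' hT.ne', neg_le_neg_iff]
  exact Real.log_le_log (mul_pos hS hT) (wilsonLimit_rectLoop_mul_le hβ.le x h R S T)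

theorem wilsonLimit_zero_coupling_rectLoop (x : Site m) {i j : Fin m} (h : i ≠ j) {R T : ℕ}
    (hR : 1 ≤ R) (hT : 1 ≤ T) : wilsonLimit 0 (rectLoop x i j R T) = 0 := by
  refine tendsto_nhds_unique (tendsto_wilsonExpect le_rfl _) (tendsto_const_nhds.congr' ?_)
  filter_upwards [eventually_mem_boxEdges (x, i)] with N hN
  refine (wilsonExpect_zero_coupling hN ?_).symm
  simp [rectLoop_apply_corner x h hR hT]

end IsingGauge

theorem mainTheorem11 (m : ℕ) (hm : 3 ≤ m) (β : ℝ) (hβ : 0 ≤ β) (R : ℕ) (hR : 1 ≤ R) :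
    (∀ (T : ℕ) (γ : IsingGauge.Chain m), 1 ≤ T → IsingGauge.IsRectLoop R T γ →
      Tendsto (fun N : ℕ => IsingGauge.wilsonExpect N β γ) atTop
        (𝓝 (IsingGauge.wilsonLimit β γ))) ∧
    (0 < β →
      (∀ (T : ℕ) (γ : IsingGauge.Chain m), 1 ≤ T → IsingGauge.IsRectLoop R T γ →
        0 < IsingGauge.wilsonLimit β γ) ∧
      ∃ V : ℝ, ∀ γ : ℕ → IsingGauge.Chain m,
        (∀ T : ℕ, 1 ≤ T → IsingGauge.IsRectLoop R T (γ T)) →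
        Tendsto (fun T : ℕ => -((1 / (T : ℝ)) * Real.log (IsingGauge.wilsonLimit β (γ T))))
          atTop (𝓝 V)) ∧
    (β = 0 → ∀ (T : ℕ) (γ : IsingGauge.Chain m), 1 ≤ T → IsingGauge.IsRectLoop R T γ →
      IsingGauge.wilsonLimit β γ = 0) := by
  have h01 : (⟨0, by omega⟩ : Fin m) ≠ ⟨1, by omega⟩ := by simp
  refine ⟨fun T γ _ _ => IsingGauge.tendsto_wilsonExpect hβ γ, fun hβ' => ⟨?_, ?_⟩, ?_⟩
  · intro T γ _ hγ
    rw [hγ.wilsonLimit_eq hβ 0 h01]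
    exact IsingGauge.wilsonLimit_rectLoop_pos hβ' 0 h01 R T
  · have hsub := IsingGauge.subadditive_neg_log_wilsonLimit hβ' 0 h01 R
    refine ⟨hsub.lim, fun γ hγ => ?_⟩
    refine (hsub.tendsto_lim ⟨0, ?_⟩).congr' ?_
    -- Fekete's lemma needs a lower bound on the quotients; 0 works because expectations are at most
    -- 1.
    · rintro _ ⟨T, rfl⟩
      exact div_nonneg (neg_nonneg.2 (Real.log_nonpos
        (IsingGauge.wilsonLimit_rectLoop_pos hβ' 0 h01 R T).le
        (IsingGauge.wilsonLimit_le_one hβ _))) T.cast_nonneg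
    -- `γ 0` is unconstrained, so the comparison with the reference rectangles starts at `T = 1`.
    · filter_upwards [eventually_ge_atTop 1] with T hT
      rw [(hγ T hT).wilsonLimit_eq hβ 0 h01]
      ring
  · rintro rfl T γ hT hγ
    rw [hγ.wilsonLimit_eq hβ 0 h01]
    exact IsingGauge.wilsonLimit_zero_coupling_rectLoop 0 h01 hR hT
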